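/- For positive integers $s_1,\dots,s_r$ with $s_1\ge 2$ let $\zeta^\star(s_1,\dots,s_r)=\sum_{k_1\ge\cdots\ge k_r\ge 1}\frac{1}{k_1^{s_1}\cdots k_r^{s_r}}$ be the multiple zeta star value (a convergent series), and let $\{a_1,\dots,a_k\}^d$ denote $d$ successive repetitions of the sequence $a_1,\dots,a_k$. Let $B_n$ be the Bernoulli numbers. For integers $m,N\ge 0$ put $$ S_m(N)=\sum_{\substack{n_0+\cdots+n_m=N\\ n_0,\dots,n_m\ge 0}}\exp\left(\frac{2\pi i}{m+1}\sum_{k=0}^m k n_k\right)\prod_{k=0}^m\left(\sum_{l=0}^{n_k}(4^{l+1}-1)\frac{B_{2l+2}}{(2l+2)!}\,\frac{B_{2n_k-2l}}{(2n_k-2l)!}\,e^{\frac{\pi i l}{m+1}}\right). $$ Then for every integer $d\ge 1$ and every integer $m\ge 0$, $$ \zeta^\star\bigl(\{\{2\}^m,3,\{2\}^m,1\}^d\bigr)=4^{m+1}\pi^{4d(m+1)}\,S_m\bigl(2(m+1)d\bigr) $$ and $$ \zeta^\star\bigl(\{\{2\}^m,3,\{2\}^m,1\}^d,\{2\}^{m+1}\bigr)=(-1)^m4^{m+1}\pi^{(4d+2)(m+1)}\,S_m\bigl((m+1)(2d+1)\bigr).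 $$ Moreover, these two values are rational multiples of $\pi^{4(m+1)d}$ and $\pi^{2(m+1)(2d+1)}$, respectively. -/

import Mathlib

open Finset

/-- The term `1 / (k₁^{s₁} ⋯ k_r^{s_r})` of the series of a multiple zeta (star) value. -/
noncomputable def mzvTerm (s : List ℕ) (k : Fin s.length → ℕ) : ℝ :=
  ∏ i, 1 / (k i : ℝ) ^ s.get i

/-- The summation range `k₁ ≥ ⋯ ≥ k_r ≥ 1` of a multiple zeta star value of depth `r`. -/
def StarIndex (r : ℕ) : Type :=
  {k : Fin r → ℕ // Antitone k ∧ ∀ i, 1 ≤ k i}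

/-- Convergence of the series defining `ζ⋆(s₁, …, s_r)`. All terms are positive, so this is the
same as absolute convergence. -/
def ZetaStarConverges (s : List ℕ) : Prop :=
  Summable fun k : StarIndex s.length => mzvTerm s k.1

/-- The multiple zeta star value `ζ⋆(s₁, …, s_r)`. -/
noncomputable def zetaStar (s : List ℕ) : ℝ :=
  ∑' k : StarIndex s.length, mzvTerm s k.1

/-- The index `{{2}^m, 3, {2}^m, 1}^d`. -/
def index321 (m d : ℕ) : List ℕ :=
  (List.replicate d (List.replicate m 2 ++ [3] ++ List.replicate m 2 ++ [1])).flatten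

/-- The convolution
`∑_{l=0}^{n} (4^{l+1} - 1) B_{2l+2}/(2l+2)! B_{2n-2l}/(2n-2l)! e^{π i l/(m+1)}`. -/
noncomputable def bernoulliConv (m n : ℕ) : ℂ :=
  ∑ l ∈ range (n + 1),
    ((4 : ℂ) ^ (l + 1) - 1) *
      ((bernoulli (2 * l + 2) : ℂ) / ((2 * l + 2).factorial : ℂ)) *
      ((bernoulli (2 * n - 2 * l) : ℂ) / ((2 * n - 2 * l).factorial : ℂ)) *
      Complex.exp (Real.pi * Complex.I * l / (m + 1))

/-- The sum over all `(n_0, …, n_m)` of non-negative integers with `n_0 + ⋯ + n_m = N` of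
`exp (2πi/(m+1) ∑ k n_k) ∏_k bernoulliConv m n_k`. -/
noncomputable def compositionSum (m N : ℕ) : ℂ :=
  ∑ n ∈ piAntidiag (univ : Finset (Fin (m + 1))) N,
    Complex.exp (2 * Real.pi * Complex.I / (m + 1) * ∑ k : Fin (m + 1), ((k : ℕ) : ℂ) * (n k : ℂ)) *
      ∏ k : Fin (m + 1), bernoulliConv m (n k)

/-! Expand truncated star sums in the kernel `K(N, k) = N!² / ((N-k)! (N+k)!)`, as `∑ c_k K(N,
k+1)`. Since `N² (K(N, k) - K(N-1, k)) = k² K(N, k)`, prepending a 2 divides `c_k` by `(k+1)²`. By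
Abel summation, multiplying by `N` applies `D = doubledSum` and the factor `k+1`; prepending 1 uses
`D`, prepending 3 its inverse. A block `{2}^m, 3, {2}^m, 1` therefore acts as `c ↦ y D(y D c)` with
`y_n = (-1)^n / n^(2m+2)`.

The increments in `n` of the coefficients of `∏_{k<n} (1 + y_k X)/(1 - y_k X)` obey the same
recursion, one factor `y D` per power of `X`. As `K(N, k) → 1`, the two star values are, up to sign,
the coefficients of `X^(2d)` and `X^(2d+1)` in the infinite product.

These coefficients satisfy Newton's recursion, whose power sums are alternating zeta values at even
integers, hence Bernoulli numbers times powers of `π`. With `φ(X) = (√X/2) coth(√X/2)` and `ω =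
e^(πi/(m+1))`, the product of `φ(ω^(2k) X)/φ(ω^(2k+1) X)` over `k ≤ m` satisfies the same recursion
after rescaling: its logarithmic derivative is filtered by roots of unity. Its coefficients are
`4^(m+1) S_m(N)`, because the convolution in `S_m` comes from `1/(4φ(ωX)) · φ(X)`. Rationality also
follows from the recursion. -/

/-- The truncated star sum `∑_{N ≥ k₁ ≥ ⋯ ≥ k_r ≥ 1} 1 / (k₁^{s₁} ⋯ k_r^{s_r})`. -/
noncomputable def truncatedStar : List ℕ → ℕ → ℝ
  | [], _ => 1
  | a :: s, N => ∑ n ∈ range N, 1 / ((n : ℝ) + 1) ^ a * truncatedStar s (n + 1)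

/-! ### Star series as limits of truncated sums -/

open Classical in
/-- The index set `N ≥ k₁ ≥ ⋯ ≥ k_r ≥ 1`. -/
noncomputable def starBox (r N : ℕ) : Finset (Fin r → ℕ) :=
  (Fintype.piFinset fun _ => Icc 1 N).filter Antitone

theorem mem_starBox {r N : ℕ} {k : Fin r → ℕ} :
    k ∈ starBox r N ↔ (∀ i, 1 ≤ k i ∧ k i ≤ N) ∧ Antitone k := by
  simp [starBox, Fintype.mem_piFinset]

theorem antitone_fin_cons {r n : ℕ} {k : Fin r → ℕ} :
    Antitone (Fin.cons n k : Fin (r + 1) → ℕ) ↔ (∀ i, k i ≤ n) ∧ Antitone k := by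
  constructor
  · intro h
    refine ⟨fun i => by simpa using h (Fin.zero_le i.succ), fun i j hij => ?_⟩
    simpa using h (Fin.succ_le_succ_iff.2 hij)
  · rintro ⟨h1, h2⟩ i j
    refine Fin.cases ?_ (fun i => ?_) i <;> refine Fin.cases ?_ (fun j => ?_) j
    · simp
    · intro _; simpa using h1 j
    · intro h; simp at h
    · intro h; simpa using h2 (Fin.succ_le_succ_iff.1 h)

theorem sum_starBox_succ (r N : ℕ) (g : (Fin (r + 1) → ℕ) → ℝ) :
    ∑ k ∈ starBox (r + 1) N, g k =
      ∑ n ∈ range N, ∑ k ∈ starBox r (n + 1), g (Fin.cons (n + 1) k) := by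
  rw [Finset.sum_sigma']
  refine Finset.sum_nbij' (fun k => ⟨k 0 - 1, Fin.tail k⟩)
    (fun p => (Fin.cons (p.1 + 1) p.2 : Fin (r + 1) → ℕ)) ?_ ?_ ?_ ?_ ?_
  · intro k hk
    obtain ⟨h1, h2⟩ := mem_starBox.1 hk
    rw [← Fin.cons_self_tail k, antitone_fin_cons] at h2
    have h0 := h1 0
    simp only [mem_sigma, mem_range, mem_starBox]
    refine ⟨by omega, fun i => ⟨(h1 i.succ).1, ?_⟩, h2.2⟩
    have := h2.1 i
    omega
  · rintro ⟨n, k⟩ h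
    simp only [mem_sigma, mem_range, mem_starBox] at h
    rw [mem_starBox, antitone_fin_cons]
    refine ⟨fun i => ?_, fun i => (h.2.1 i).2, h.2.2⟩
    refine Fin.cases ?_ (fun i => ?_) i
    · simp only [Fin.cons_zero]; omega
    · have := h.2.1 i
      simp only [Fin.cons_succ]; omega
  · intro k hk
    have h0 := (mem_starBox.1 hk).1 0
    have : k 0 - 1 + 1 = k 0 := by omega
    simp only [this, Fin.cons_self_tail]
  · rintro ⟨n, k⟩ _
    simp
  · intro k hk
    have h0 := (mem_starBox.1 hk).1 0
    have : k 0 - 1 + 1 = k 0 := by omega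
    simp only [this, Fin.cons_self_tail]

theorem mzvTerm_cons (a : ℕ) (s : List ℕ) (n : ℕ) (k : Fin s.length → ℕ) :
    mzvTerm (a :: s) (Fin.cons n k : Fin (s.length + 1) → ℕ) = 1 / (n : ℝ) ^ a * mzvTerm s k := by
  unfold mzvTerm
  exact (Fin.prod_univ_succ _).trans rfl

theorem sum_starBox_mzvTerm (s : List ℕ) (N : ℕ) :
    ∑ k ∈ starBox s.length N, mzvTerm s k = truncatedStar s N := by
  induction s generalizing N with
  | nil =>
    have : starBox ([] : List ℕ).length N = {Fin.elim0} := by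
      ext k
      rw [mem_starBox, mem_singleton]
      exact ⟨fun _ => funext fun i => i.elim0, fun _ => ⟨fun i => i.elim0, fun i => i.elim0⟩⟩
    rw [this, sum_singleton, truncatedStar]
    exact Fin.prod_univ_zero _
  | cons a s ih =>
    refine (sum_starBox_succ s.length N _).trans ?_
    simp only [truncatedStar]
    refine sum_congr rfl fun n _ => ?_
    rw [← ih, mul_sum]
    refine sum_congr rfl fun k _ => ?_
    rw [mzvTerm_cons]
    push_cast
    rfl

/-- The terms are nonnegative and the boxes exhaust the index set, so convergence along boxes
already gives summability. -/
theorem hasSum_mzvTerm_of_tendsto {s : List ℕ} {L : ℝ}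
    (h : Filter.Tendsto (truncatedStar s) Filter.atTop (nhds L)) :
    HasSum (fun k : StarIndex s.length => mzvTerm s k.1) L := by
  classical
  let box : ℕ → Finset (StarIndex s.length) := fun N =>
    (starBox s.length N).subtype fun k => Antitone k ∧ ∀ i, 1 ≤ k i
  have mem_box (N : ℕ) (k : StarIndex s.length) : k ∈ box N ↔ ∀ i, k.1 i ≤ N := by
    refine Finset.mem_subtype.trans (mem_starBox.trans ?_)
    exact ⟨fun h i => (h.1 i).2, fun h => ⟨fun i => ⟨k.2.2 i, h i⟩, k.2.1⟩⟩
  have hsum (N : ℕ) : ∑ k ∈ box N, mzvTerm s k.1 = truncatedStar s N := by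
    rw [← sum_starBox_mzvTerm]
    exact Finset.sum_subtype_of_mem (fun k => mzvTerm s k)
      fun k hk => ⟨(mem_starBox.1 hk).2, fun i => ((mem_starBox.1 hk).1 i).1⟩
  have hmono : Monotone box := fun M N hMN k hk =>
    (mem_box N k).2 fun i => ((mem_box M k).1 hk i).trans hMN
  have hbox : Filter.Tendsto box Filter.atTop Filter.atTop := by
    refine Filter.tendsto_atTop_finset_of_monotone hmono fun k => ⟨∑ i, k.1 i, ?_⟩
    exact (mem_box _ _).2 fun i => Finset.single_le_sum (fun _ _ => Nat.zero_le _) (mem_univ i)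
  have hnn : 0 ≤ fun k : StarIndex s.length => mzvTerm s k.1 := fun k =>
    Finset.prod_nonneg fun i _ => by positivity
  have hsummable : Summable fun k : StarIndex s.length => mzvTerm s k.1 := by
    refine summable_of_sum_le hnn (c := L) fun u => ?_
    have hev : ∀ᶠ N in Filter.atTop, u ⊆ box N := hbox.eventually_ge_atTop u
    refine ge_of_tendsto h (hev.mono fun N hN => ?_)
    rw [← hsum]
    exact Finset.sum_le_sum_of_subset_of_nonneg hN fun k _ _ => hnn k
  have := hsummable.hasSum.comp hbox
  have heq : L = ∑' k : StarIndex s.length, mzvTerm s k.1 :=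
    tendsto_nhds_unique h (this.congr hsum)
  rw [heq]
  exact hsummable.hasSum

/-! ### The kernel and multiplication by `N` -/

/-- The kernel `N!² / ((N - k)! (N + k)!)`, which vanishes for `k > N`. -/
noncomputable def starKernel (N k : ℕ) : ℝ :=
  ∏ i ∈ range k, ((N : ℝ) - i) / (N + 1 + i)

theorem starKernel_zero_right (N : ℕ) : starKernel N 0 = 1 := by simp [starKernel]

theorem starKernel_succ_mul (N k : ℕ) :
    ((N : ℝ) + k + 1) * starKernel N (k + 1) = (N - k) * starKernel N k := by
  have : (N : ℝ) + 1 + k ≠ 0 := by positivity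
  rw [starKernel, prod_range_succ, ← starKernel]
  field_simp
  ring

theorem starKernel_of_lt {N k : ℕ} (h : N < k) : starKernel N k = 0 :=
  prod_eq_zero (mem_range.2 h) (by simp)

theorem starKernel_mem_Icc (N k : ℕ) : 0 ≤ starKernel N k ∧ starKernel N k ≤ 1 := by
  rcases lt_or_ge N k with h | h
  · simp [starKernel_of_lt h]
  · have hi (i : ℕ) (hi : i ∈ range k) : 0 ≤ (N : ℝ) - i := by
      have : (i : ℝ) ≤ N := by exact_mod_cast (mem_range.1 hi).le.trans h
      linarith
    refine ⟨prod_nonneg fun i h' => div_nonneg (hi i h') (by positivity),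
      prod_le_one (fun i h' => div_nonneg (hi i h') (by positivity)) fun i h' => ?_⟩
    rw [div_le_one (by positivity)]
    linarith [(Nat.cast_nonneg i : (0 : ℝ) ≤ i)]

/-- Makes the kernel an eigenfunction, with eigenvalue `k²`, of `(N+1)²` times the difference in
`N`. -/
theorem starKernel_succ_left (N k : ℕ) :
    ((N : ℝ) + 1) ^ 2 * starKernel N k =
      ((N : ℝ) + 1 - k) * (N + 1 + k) * starKernel (N + 1) k := by
  induction k with
  | zero => simp [starKernel_zero_right]; ring
  | succ k ih =>
    have h1 := starKernel_succ_mul N k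
    have h2 := starKernel_succ_mul (N + 1) k
    have h3 : (N : ℝ) + k + 1 ≠ 0 := by positivity
    push_cast at h2 ⊢
    apply mul_left_cancel₀ h3
    linear_combination ((N : ℝ) + 1) ^ 2 * h1 + (N - k) * ih - (N - k) * (N + k + 1) * h2

theorem tendsto_starKernel (k : ℕ) :
    Filter.Tendsto (fun N => starKernel N k) Filter.atTop (nhds 1) := by
  have h : Filter.Tendsto (fun N : ℕ => ∏ i ∈ range k, ((N : ℝ) - i) / (N + 1 + i))
      Filter.atTop (nhds (∏ i ∈ range k, (1 : ℝ))) := by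
    refine tendsto_finsetProd _ fun i _ => ?_
    have h1 : Filter.Tendsto (fun N : ℕ => 1 - (2 * (i : ℝ) + 1) / ((N : ℝ) + (1 + i)))
        Filter.atTop (nhds (1 - 0)) :=
      tendsto_const_nhds.sub ((Filter.tendsto_atTop_add_const_right _ _
        tendsto_natCast_atTop_atTop).const_div_atTop _)
    rw [sub_zero] at h1
    refine h1.congr fun N => ?_
    have : (N : ℝ) + 1 + i ≠ 0 := by positivity
    field_simp
    ring
  simpa [starKernel] using h

/-- `x j + 2 ∑_{k < j} x k`. -/
noncomputable def doubledSum (x : ℕ → ℝ) (j : ℕ) : ℝ := x j + 2 * ∑ k ∈ range j, x k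

/-- Summation by parts via `starKernel_succ_mul`; the boundary term vanishes at `M = N`. -/
theorem mul_sum_starKernel_aux (N : ℕ) (e : ℕ → ℝ) (M : ℕ) :
    N * ∑ k ∈ range M, e k * starKernel N (k + 1) =
      ∑ j ∈ range M, ((j : ℝ) + 1) * doubledSum e j * starKernel N (j + 1) +
        (∑ k ∈ range M, e k) * ((N - M) * starKernel N M) := by
  induction M with
  | zero => simp
  | succ M ih =>
    have h := starKernel_succ_mul N M
    simp only [sum_range_succ, mul_add, ih]
    rw [doubledSum]
    push_cast
    linear_combination (-∑ k ∈ range M, e k) * h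

theorem mul_sum_starKernel (N : ℕ) (e : ℕ → ℝ) :
    N * ∑ k ∈ range N, e k * starKernel N (k + 1) =
      ∑ j ∈ range N, ((j : ℝ) + 1) * doubledSum e j * starKernel N (j + 1) := by
  simp [mul_sum_starKernel_aux]

theorem sum_starKernel (N M : ℕ) :
    ∑ j ∈ range M, ((j : ℝ) + 1) * 2 * starKernel N (j + 1) = N - (N - M) * starKernel N M := by
  induction M with
  | zero => simp [starKernel_zero_right]
  | succ M ih =>
    have h := starKernel_succ_mul N M
    rw [sum_range_succ, ih]
    push_cast
    linear_combination h

theorem doubledSum_succ_sub (x : ℕ → ℝ) (j : ℕ) :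
    doubledSum x (j + 1) = doubledSum x j + x (j + 1) + x j := by
  simp only [doubledSum, sum_range_succ]
  ring

theorem doubledSum_alternating (j : ℕ) : doubledSum (fun k => 2 * (-1) ^ k) j = 2 := by
  induction j with
  | zero => simp [doubledSum]
  | succ j ih => rw [doubledSum_succ_sub, ih]; ring

/-- On generating functions `doubledSum` is multiplication by `(1+x)/(1-x)`; conjugation by signs
replaces `x` by `-x` and so inverts it. -/
theorem doubledSum_sign_doubledSum (v : ℕ → ℝ) (j : ℕ) :
    doubledSum (fun k => (-1) ^ k * doubledSum (fun i => (-1) ^ i * v i) k) j = v j := by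
  induction j with
  | zero => simp [doubledSum]
  | succ j ih =>
    rw [doubledSum_succ_sub, ih, doubledSum_succ_sub]
    have : ((-1 : ℝ) ^ j) ^ 2 = 1 := by rw [← pow_mul, mul_comm, pow_mul]; simp
    rw [pow_succ]
    linear_combination (v (j + 1) - v j) * this

/-! ### Effect of prepending 1, 2, 3 on kernel coefficients -/

/-- `c` is the coefficient sequence of the truncated star sums of `s` in terms of the kernel. -/
def HasStarCoeff (s : List ℕ) (c : ℕ → ℝ) : Prop :=
  ∀ N, truncatedStar s (N + 1) = ∑ k ∈ range (N + 1), c k * starKernel (N + 1) (k + 1)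

/-- After multiplication by `N + 1` the sum telescopes. The expansion fails at `N = 0`, where the
empty index still gives 1. -/
theorem hasStarCoeff_nil : HasStarCoeff [] fun k => 2 * (-1) ^ k := by
  intro N
  have h := mul_sum_starKernel (N + 1) fun k => 2 * (-1) ^ k
  simp only [doubledSum_alternating, sum_starKernel, sub_self, zero_mul, sub_zero] at h
  have h0 : ((N + 1 : ℕ) : ℝ) ≠ 0 := by positivity
  rw [truncatedStar]
  exact (mul_left_cancel₀ h0 (h.trans (mul_one _).symm)).symm

/-- Both sides vanish at `N = 0`. By the eigenvalue relation, `h` says that their increments agree.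
-/
theorem HasStarCoeff.cons {s : List ℕ} {c c' : ℕ → ℝ} {a : ℕ} (hc : HasStarCoeff s c)
    (h : ∀ N : ℕ, ((N : ℝ) + 1) ^ a *
        ∑ k ∈ range (N + 1), ((k : ℝ) + 1) ^ 2 * c' k * starKernel (N + 1) (k + 1) =
      ((N : ℝ) + 1) ^ 2 * ∑ k ∈ range (N + 1), c k * starKernel (N + 1) (k + 1)) :
    HasStarCoeff (a :: s) c' := by
  have key (N : ℕ) : truncatedStar (a :: s) N = ∑ k ∈ range N, c' k * starKernel N (k + 1) := by
    induction N with
    | zero => simp [truncatedStar]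
    | succ N ih =>
      have h0 : (N : ℝ) + 1 ≠ 0 := by positivity
      have hlast : ∑ k ∈ range N, c' k * starKernel N (k + 1) =
          ∑ k ∈ range (N + 1), c' k * starKernel N (k + 1) := by
        rw [sum_range_succ, starKernel_of_lt (Nat.lt_succ_self N), mul_zero, add_zero]
      have hstep : ((N : ℝ) + 1) ^ 2 * (∑ k ∈ range (N + 1), c' k * starKernel (N + 1) (k + 1) -
          ∑ k ∈ range (N + 1), c' k * starKernel N (k + 1)) =
          ∑ k ∈ range (N + 1), ((k : ℝ) + 1) ^ 2 * c' k * starKernel (N + 1) (k + 1) := by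
        rw [← sum_sub_distrib, mul_sum]
        refine sum_congr rfl fun k _ => ?_
        have := starKernel_succ_left N (k + 1)
        push_cast at this
        linear_combination (-c' k) * this
      have hsucc : truncatedStar (a :: s) (N + 1) = truncatedStar (a :: s) N +
          1 / ((N : ℝ) + 1) ^ a * truncatedStar s (N + 1) := by
        simp only [truncatedStar, sum_range_succ]
      rw [hsucc, hc N, ih, hlast]
      have h2 := h N
      rw [← hstep] at h2
      have ha : ((N : ℝ) + 1) ^ a ≠ 0 := pow_ne_zero _ h0
      have h3 : ((N : ℝ) + 1) ^ 2 ≠ 0 := pow_ne_zero _ h0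
      apply mul_left_cancel₀ h3
      apply mul_left_cancel₀ ha
      generalize ∑ k ∈ range (N + 1), c' k * starKernel N (k + 1) = A at *
      generalize ∑ k ∈ range (N + 1), c' k * starKernel (N + 1) (k + 1) = B at *
      generalize ∑ k ∈ range (N + 1), c k * starKernel (N + 1) (k + 1) = D at *
      linear_combination -h2 + ((N : ℝ) + 1) ^ 2 * D * mul_one_div_cancel ha
  exact fun N => key (N + 1)

theorem HasStarCoeff.cons_two {s : List ℕ} {c : ℕ → ℝ} (hc : HasStarCoeff s c) :
    HasStarCoeff (2 :: s) fun k => c k / ((k : ℝ) + 1) ^ 2 := by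
  refine hc.cons fun N => ?_
  congr 1
  refine sum_congr rfl fun k _ => ?_
  have : (k : ℝ) + 1 ≠ 0 := by positivity
  field_simp

theorem HasStarCoeff.cons_one {s : List ℕ} {c : ℕ → ℝ} (hc : HasStarCoeff s c) :
    HasStarCoeff (1 :: s) fun k => doubledSum c k / ((k : ℝ) + 1) := by
  refine hc.cons fun N => ?_
  have h := mul_sum_starKernel (N + 1) c
  push_cast at h
  rw [pow_one, sq ((N : ℝ) + 1), mul_assoc, h]
  congr 1
  refine sum_congr rfl fun k _ => ?_
  have : (k : ℝ) + 1 ≠ 0 := by positivity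
  field_simp

/-- One more factor `N + 1` than for 2 must be divided out, which the sign-conjugated inverse of
`doubledSum` does. -/
theorem HasStarCoeff.cons_three {s : List ℕ} {c : ℕ → ℝ} (hc : HasStarCoeff s c) :
    HasStarCoeff (3 :: s) fun k =>
      (-1) ^ k * doubledSum (fun i => (-1) ^ i * (c i / ((i : ℝ) + 1))) k / ((k : ℝ) + 1) ^ 2 := by
  refine hc.cons fun N => ?_
  have h := mul_sum_starKernel (N + 1)
    fun k => (-1) ^ k * doubledSum (fun i => (-1) ^ i * (c i / ((i : ℝ) + 1))) k
  simp only [doubledSum_sign_doubledSum] at h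
  push_cast at h
  have e1 : ∑ k ∈ range (N + 1), ((k : ℝ) + 1) ^ 2 * ((-1) ^ k *
      doubledSum (fun i => (-1) ^ i * (c i / ((i : ℝ) + 1))) k / ((k : ℝ) + 1) ^ 2) *
        starKernel (N + 1) (k + 1) = ∑ k ∈ range (N + 1), (-1) ^ k *
      doubledSum (fun i => (-1) ^ i * (c i / ((i : ℝ) + 1))) k * starKernel (N + 1) (k + 1) := by
    refine sum_congr rfl fun k _ => ?_
    have : (k : ℝ) + 1 ≠ 0 := by positivity
    field_simp
  rw [e1, pow_succ, mul_assoc, h]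
  congr 1
  refine sum_congr rfl fun k _ => ?_
  have : (k : ℝ) + 1 ≠ 0 := by positivity
  field_simp

theorem HasStarCoeff.replicate_two {s : List ℕ} {c : ℕ → ℝ} (hc : HasStarCoeff s c) (m : ℕ) :
    HasStarCoeff (List.replicate m 2 ++ s) fun k => c k / ((k : ℝ) + 1) ^ (2 * m) := by
  induction m with
  | zero => simpa using hc
  | succ m ih =>
    rw [List.replicate_succ, List.cons_append]
    convert ih.cons_two using 2 with k
    rw [div_div, ← pow_add]
    ring_nf

/-- Dominated convergence: the kernel lies in `[0, 1]` and tends to 1. -/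
theorem HasStarCoeff.tendsto {s : List ℕ} {c : ℕ → ℝ} (hc : HasStarCoeff s c)
    (hs : Summable fun k => |c k|) :
    Filter.Tendsto (truncatedStar s) Filter.atTop (nhds (∑' k, c k)) := by
  have h : Filter.Tendsto (fun N => ∑' k, c k * starKernel N (k + 1)) Filter.atTop
      (nhds (∑' k, c k)) := by
    refine tendsto_tsum_of_dominated_convergence hs (fun k => ?_) (.of_forall fun N k => ?_)
    · simpa using (tendsto_starKernel (k + 1)).const_mul (c k)
    · obtain ⟨h0, h1⟩ := starKernel_mem_Icc N (k + 1)
      rw [norm_mul, Real.norm_eq_abs, Real.norm_of_nonneg h0]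
      exact mul_le_of_le_one_right (abs_nonneg _) h1
  refine h.congr' ((Filter.eventually_ge_atTop 1).mono fun N hN => ?_)
  obtain ⟨N, rfl⟩ := Nat.exists_eq_add_of_le' hN
  rw [hc N]
  refine tsum_eq_sum fun k hk => ?_
  rw [starKernel_of_lt (by simpa using hk), mul_zero]

/-! ### Logarithmic derivatives and Cayley factors -/

namespace PowerSeries

/-- The derivation `X d/dX` on power series. -/
noncomputable def eulerDeriv (R : Type*) [CommRing R] :
    Derivation R (PowerSeries R) (PowerSeries R) :=
  (X : PowerSeries R) • derivative R

variable {R : Type*} [CommRing R]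

theorem eulerDeriv_apply (f : PowerSeries R) : eulerDeriv R f = X * derivative R f := rfl

theorem coeff_eulerDeriv (f : PowerSeries R) (n : ℕ) :
    coeff n (eulerDeriv R f) = n * coeff n f := by
  rw [eulerDeriv_apply]
  cases n with
  | zero => simp
  | succ n => rw [coeff_succ_X_mul, coeff_derivative, mul_comm]; push_cast; rfl

theorem eulerDeriv_rescale (a : R) (f : PowerSeries R) :
    eulerDeriv R (rescale a f) = rescale a (eulerDeriv R f) := by
  ext n
  simp only [coeff_eulerDeriv, coeff_rescale]
  ring

/-- `b` is the logarithmic derivative of `f` with respect to `X d/dX`. -/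
def HasLogDeriv (f b : PowerSeries R) : Prop := eulerDeriv R f = f * b

theorem HasLogDeriv.mul {f g b c : PowerSeries R} (hf : HasLogDeriv f b) (hg : HasLogDeriv g c) :
    HasLogDeriv (f * g) (b + c) := by
  unfold HasLogDeriv at *
  rw [Derivation.leibniz, hf, hg]
  simp only [smul_eq_mul]
  ring

theorem HasLogDeriv.prod {ι : Type*} (s : Finset ι) {f b : ι → PowerSeries R}
    (h : ∀ i ∈ s, HasLogDeriv (f i) (b i)) : HasLogDeriv (∏ i ∈ s, f i) (∑ i ∈ s, b i) := by
  classical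
  induction s using Finset.induction_on with
  | empty => simp [HasLogDeriv]
  | insert i s hi ih =>
    rw [prod_insert hi, sum_insert hi]
    exact (h i (mem_insert_self i s)).mul (ih fun j hj => h j (mem_insert_of_mem hj))

theorem HasLogDeriv.of_mul_eq_one {f g b : PowerSeries R} (hf : HasLogDeriv f b)
    (h : f * g = 1) : HasLogDeriv g (-b) := by
  unfold HasLogDeriv at *
  have := congrArg (eulerDeriv R) h
  rw [Derivation.leibniz, hf, Derivation.map_one_eq_zero] at this
  simp only [smul_eq_mul] at this
  linear_combination g * this - (eulerDeriv R g + g * b) * h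

theorem HasLogDeriv.rescale {f b : PowerSeries R} (hf : HasLogDeriv f b) (a : R) :
    HasLogDeriv (rescale a f) (PowerSeries.rescale a b) := by
  unfold HasLogDeriv at *
  rw [eulerDeriv_rescale, hf, map_mul]

theorem HasLogDeriv.coeff {f b : PowerSeries R} (hf : HasLogDeriv f b) (n : ℕ) :
    n * coeff n f = ∑ p ∈ antidiagonal n, PowerSeries.coeff p.1 f * PowerSeries.coeff p.2 b := by
  rw [← coeff_eulerDeriv, hf, coeff_mul]

theorem mk_pow_mul_one_sub (y : R) : (mk fun j => y ^ j) * (1 - C y * X) = 1 := by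
  have h : (mk fun j => y ^ j) = rescale y (mk (1 : ℕ → R)) := by ext; simp
  have h1 : 1 - C y * X = rescale y (1 - X) := by simp [rescale_X]
  rw [h, h1, ← map_mul, mk_one_mul_one_sub_eq_one, map_one]

/-- The power series of `(1 + y X) / (1 - y X)`. -/
noncomputable def cayley (y : R) : PowerSeries R := (1 + C y * X) * mk fun j => y ^ j

theorem cayley_mul (y : R) : cayley y * (1 - C y * X) = 1 + C y * X := by
  rw [cayley, mul_assoc, mk_pow_mul_one_sub, mul_one]

theorem hasLogDeriv_one_sub (y : R) :
    HasLogDeriv (1 - C y * X) (1 - mk fun j => y ^ j) := by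
  unfold HasLogDeriv
  rw [eulerDeriv_apply, mul_sub, mul_comm _ (mk _), mk_pow_mul_one_sub]
  simp
  ring

theorem hasLogDeriv_cayley (y : R) :
    HasLogDeriv (cayley y) (mk fun j => y ^ j - (-y) ^ j) := by
  have h1 := hasLogDeriv_one_sub (-y)
  have h2 := (hasLogDeriv_one_sub y).of_mul_eq_one
    ((mul_comm _ _).trans (mk_pow_mul_one_sub y))
  have h3 := h1.mul h2
  rw [map_neg, neg_mul, sub_neg_eq_add] at h3
  have e : (mk fun j => y ^ j - (-y) ^ j) =
      (1 - mk fun j => (-y) ^ j) + -(1 - mk fun j => y ^ j) := by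
    ext n
    simp only [map_add, map_sub, map_neg, coeff_mk]
    ring
  rw [e]
  exact h3

end PowerSeries

/-! ### Coefficients of Cayley products and their limits -/

open PowerSeries in
/-- The coefficient of `X ^ r` in `∏_{k < n} (1 + y k X) / (1 - y k X)`. -/
noncomputable def cayleyCoeff (y : ℕ → ℝ) (r n : ℕ) : ℝ :=
  coeff r (∏ k ∈ range n, cayley (y k))

theorem cayleyCoeff_zero_right (y : ℕ → ℝ) {r : ℕ} (hr : r ≠ 0) : cayleyCoeff y r 0 = 0 := by
  simp [cayleyCoeff, PowerSeries.coeff_one, hr]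

theorem cayleyCoeff_zero_left (y : ℕ → ℝ) (n : ℕ) : cayleyCoeff y 0 n = 1 := by
  have h (x : ℝ) : PowerSeries.constantCoeff (PowerSeries.mk fun j => x ^ j) = 1 := by
    rw [← PowerSeries.coeff_zero_eq_constantCoeff_apply, PowerSeries.coeff_mk, pow_zero]
  rw [cayleyCoeff, PowerSeries.coeff_zero_eq_constantCoeff_apply, map_prod]
  simp [PowerSeries.cayley, h]

theorem cayleyCoeff_succ_sub (y : ℕ → ℝ) (r n : ℕ) :
    cayleyCoeff y (r + 1) (n + 1) - cayleyCoeff y (r + 1) n =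
      y n * (cayleyCoeff y r (n + 1) + cayleyCoeff y r n) := by
  have h : (∏ k ∈ range (n + 1), PowerSeries.cayley (y k)) *
        (1 - PowerSeries.C (y n) * PowerSeries.X) =
      (∏ k ∈ range n, PowerSeries.cayley (y k)) * (1 + PowerSeries.C (y n) * PowerSeries.X) := by
    rw [prod_range_succ, mul_assoc, PowerSeries.cayley_mul]
  have h2 := congrArg (PowerSeries.coeff (r + 1)) h
  rw [mul_sub, mul_add, mul_one, mul_one, mul_left_comm, mul_left_comm (∏ k ∈ range n, _)] at h2
  simp only [map_sub, map_add, PowerSeries.coeff_C_mul, PowerSeries.coeff_succ_mul_X] at h2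
  unfold cayleyCoeff
  linear_combination h2

theorem sum_cayleyCoeff_succ_sub (y : ℕ → ℝ) (r n : ℕ) :
    ∑ k ∈ range n, (cayleyCoeff y (r + 1) (k + 1) - cayleyCoeff y (r + 1) k) =
      cayleyCoeff y (r + 1) n := by
  rw [sum_range_sub, cayleyCoeff_zero_right y r.succ_ne_zero, sub_zero]

/-- The increments in `n` of `cayleyCoeff y (r + 1) n`. -/
noncomputable def cayleyIncr (y : ℕ → ℝ) (r n : ℕ) : ℝ :=
  cayleyCoeff y (r + 1) (n + 1) - cayleyCoeff y (r + 1) n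

theorem cayleyIncr_zero (y : ℕ → ℝ) (n : ℕ) : cayleyIncr y 0 n = 2 * y n := by
  rw [cayleyIncr, cayleyCoeff_succ_sub, cayleyCoeff_zero_left, cayleyCoeff_zero_left]
  ring

/-- Clearing the denominator of the last factor gives `y_n` times the sum of two consecutive
coefficients; telescoping turns that sum into `doubledSum` of the increments. -/
theorem cayleyIncr_succ (y : ℕ → ℝ) (r n : ℕ) :
    cayleyIncr y (r + 1) n = y n * doubledSum (cayleyIncr y r) n := by
  rw [cayleyIncr, cayleyCoeff_succ_sub, doubledSum]
  unfold cayleyIncr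
  rw [sum_cayleyCoeff_succ_sub]
  ring

theorem mul_cayleyCoeff (y : ℕ → ℝ) (r n : ℕ) :
    r * cayleyCoeff y r n = ∑ p ∈ antidiagonal r,
      cayleyCoeff y p.1 n * ∑ k ∈ range n, (y k ^ p.2 - (-y k) ^ p.2) := by
  have h := (PowerSeries.HasLogDeriv.prod (range n)
    fun k _ => PowerSeries.hasLogDeriv_cayley (y k)).coeff r
  simpa only [map_sum, PowerSeries.coeff_mk] using! h

open Filter Topology in
/-- If the odd power sums of `y` converge then so do the coefficients of the product of the
`(1 + y k X) / (1 - y k X)`, and the limits satisfy Newton's recursion. -/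
theorem exists_tendsto_cayleyCoeff {y p : ℕ → ℝ}
    (hp : ∀ j, Tendsto (fun n => ∑ k ∈ range n, (y k ^ j - (-y k) ^ j)) atTop (𝓝 (p j))) :
    ∃ q : ℕ → ℝ, q 0 = 1 ∧ (∀ r, Tendsto (cayleyCoeff y r) atTop (𝓝 (q r))) ∧
      ∀ r : ℕ, r * q r = ∑ i ∈ antidiagonal r, q i.1 * p i.2 := by
  have hex (r : ℕ) : ∃ L, Tendsto (cayleyCoeff y r) atTop (𝓝 L) := by
    induction r using Nat.strong_induction_on with
    | _ r ih =>
      rcases Nat.eq_zero_or_pos r with rfl | hr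
      · exact ⟨1, by simp [funext (cayleyCoeff_zero_left y)]⟩
      · have hterm (i : ℕ × ℕ) (hi : i ∈ antidiagonal r) : ∃ L, Tendsto (fun n =>
            cayleyCoeff y i.1 n * ∑ k ∈ range n, (y k ^ i.2 - (-y k) ^ i.2)) atTop (𝓝 L) := by
          rw [HasAntidiagonal.mem_antidiagonal] at hi
          -- The pair `(r, 0)` escapes the induction hypothesis, but its power sum factor is zero.
          rcases Nat.eq_zero_or_pos i.2 with h0 | h0
          · exact ⟨0, by simp [h0]⟩
          · obtain ⟨L, hL⟩ := ih i.1 (by omega)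
            exact ⟨_, hL.mul (hp i.2)⟩
        choose! L hL using hterm
        refine ⟨(r : ℝ)⁻¹ * ∑ i ∈ antidiagonal r, L i,
          ((tendsto_finsetSum _ hL).const_mul _).congr fun n => ?_⟩
        rw [← mul_cayleyCoeff, inv_mul_cancel_left₀ (by positivity)]
  choose q hq using hex
  refine ⟨q, ?_, hq, fun r => ?_⟩
  · exact tendsto_nhds_unique (hq 0) (by simp [funext (cayleyCoeff_zero_left y)])
  · exact tendsto_nhds_unique ((hq r).const_mul (r : ℝ))
      ((tendsto_finsetSum _ fun i _ => (hq i.1).mul (hp i.2)).congr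
        fun n => (mul_cayleyCoeff y r n).symm)

open Filter Topology in
-- Convergent coefficients are bounded, so the increments are dominated by a multiple of `|y k|`;
-- their sum telescopes.
theorem hasSum_cayleyIncr {y : ℕ → ℝ} (hy : Summable fun k => |y k|) {r : ℕ} {q q' : ℝ}
    (hq : Tendsto (cayleyCoeff y r) atTop (𝓝 q))
    (hq' : Tendsto (cayleyCoeff y (r + 1)) atTop (𝓝 q')) :
    (Summable fun k => |cayleyIncr y r k|) ∧ ∑' k, cayleyIncr y r k = q' := by
  have hs : Summable fun k => |cayleyIncr y r k| := by
    obtain ⟨M, hM⟩ := hq.abs.bddAbove_range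
    have hM' (n : ℕ) : |cayleyCoeff y r n| ≤ M := hM ⟨n, rfl⟩
    refine Summable.of_nonneg_of_le (fun k => abs_nonneg _) (fun k => ?_) (hy.mul_right (2 * M))
    rw [cayleyIncr, cayleyCoeff_succ_sub, abs_mul]
    gcongr
    linarith [abs_add_le (cayleyCoeff y r (k + 1)) (cayleyCoeff y r k), hM' k, hM' (k + 1)]
  refine ⟨hs, tendsto_nhds_unique hs.of_abs.hasSum.tendsto_sum_nat (hq'.congr fun n => ?_)⟩
  exact (sum_cayleyCoeff_succ_sub y r n).symm

/-! ### The hyperbolic cotangent series -/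

open PowerSeries

/-- The power series `∑ B_{2n} / (2n)! X^n`, which is `(√X / 2) coth (√X / 2)`. -/
noncomputable def evenBernoulliSeries : ℂ⟦X⟧ :=
  PowerSeries.mk fun n => (bernoulli (2 * n) : ℂ) / ((2 * n).factorial : ℂ)

/-- The power series `∑ (4^{l+1} - 1) B_{2l+2} / (2l+2)! X^l`. -/
noncomputable def tangentBernoulliSeries : ℂ⟦X⟧ :=
  PowerSeries.mk fun l => ((4 : ℂ) ^ (l + 1) - 1) *
    ((bernoulli (2 * l + 2) : ℂ) / ((2 * l + 2).factorial : ℂ))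

theorem X_mul_tangentBernoulliSeries :
    X * tangentBernoulliSeries = rescale 4 evenBernoulliSeries - evenBernoulliSeries := by
  ext n
  cases n with
  | zero => simp only [map_sub, coeff_rescale, coeff_zero_X_mul, pow_zero, one_mul, sub_self]
  | succ n =>
    rw [coeff_succ_X_mul]
    simp only [tangentBernoulliSeries, evenBernoulliSeries, map_sub, coeff_rescale, coeff_mk,
      mul_add, mul_one]
    ring

/-- Adding `X/2` cancels `B_1 = -1/2`, the only nonzero odd Bernoulli number. -/
theorem expand_evenBernoulliSeries :
    expand 2 two_ne_zero evenBernoulliSeries =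
      bernoulliPowerSeries ℂ + C (1 / 2 : ℂ) * X := by
  ext n
  rcases Nat.even_or_odd' n with ⟨k, rfl | rfl⟩
  · rw [coeff_expand_mul]
    have : 2 * k ≠ 1 := by omega
    simp [evenBernoulliSeries, bernoulliPowerSeries, coeff_X, this]
  · rw [coeff_expand_of_not_dvd _ _ _ (by omega)]
    rcases Nat.eq_zero_or_pos k with rfl | hk
    · norm_num [bernoulliPowerSeries]
    · have h2 : bernoulli (2 * k + 1) = 0 :=
        bernoulli_eq_zero_of_odd (odd_two_mul_add_one k) (by omega)
      simp [bernoulliPowerSeries, coeff_C, hk.ne', h2]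

theorem expand_two_injective : Function.Injective (expand 2 two_ne_zero : ℂ⟦X⟧ → ℂ⟦X⟧) := by
  intro f g h
  ext n
  rw [← coeff_expand_mul 2 two_ne_zero f n, h, coeff_expand_mul]

theorem exp_sub_one_ne_zero : exp ℂ - 1 ≠ 0 := by
  intro h
  have := bernoulliPowerSeries_mul_exp_sub_one ℂ
  rw [h, mul_zero] at this
  exact X_ne_zero this.symm

theorem expand_evenBernoulliSeries_mul :
    2 * expand 2 two_ne_zero evenBernoulliSeries * (exp ℂ - 1) = X * (exp ℂ + 1) := by
  have h := bernoulliPowerSeries_mul_exp_sub_one ℂ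
  have h2 : (2 : ℂ⟦X⟧) * C (1 / 2 : ℂ) = 1 := by
    rw [← map_ofNat (C (R := ℂ)) 2, ← map_mul]; simp
  rw [expand_evenBernoulliSeries]
  linear_combination 2 * h + X * (exp ℂ - 1) * h2

theorem expand_rescale_evenBernoulliSeries :
    expand 2 two_ne_zero (rescale 4 evenBernoulliSeries) =
      rescale 2 (expand 2 two_ne_zero evenBernoulliSeries) := by
  ext n
  rcases Nat.even_or_odd' n with ⟨k, rfl | rfl⟩
  · rw [coeff_expand_mul, coeff_rescale, coeff_rescale, coeff_expand_mul, pow_mul]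
    norm_num
  · rw [coeff_rescale, coeff_expand_of_not_dvd _ _ _ (by omega),
      coeff_expand_of_not_dvd _ _ _ (by omega), mul_zero]

theorem exp_add_one_ne_zero : exp ℂ + 1 ≠ 0 := by
  intro h
  have := congrArg constantCoeff h
  simp at this

/-- The duplication formula of the hyperbolic cotangent. -/
theorem evenBernoulliSeries_duplication :
    4 * (rescale 4 evenBernoulliSeries - evenBernoulliSeries) * evenBernoulliSeries = X := by
  apply expand_two_injective
  have h := expand_evenBernoulliSeries_mul
  have h2 := congrArg (rescale (2 : ℂ)) h
  have hexp : rescale (2 : ℂ) (exp ℂ) = exp ℂ ^ 2 := by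
    simpa using (exp_pow_eq_rescale_exp (A := ℂ) 2).symm
  simp only [map_mul, map_sub, map_add, map_one, hexp, map_ofNat, rescale_X] at h2
  simp only [map_mul, map_sub, map_ofNat, expand_rescale_evenBernoulliSeries, expand_X]
  generalize rescale 2 (expand 2 two_ne_zero evenBernoulliSeries) = D at *
  generalize expand 2 two_ne_zero evenBernoulliSeries = P at *
  -- The product of the denominators `e^X - 1` and `e^(2X) - 1`.
  have hne : (exp ℂ - 1) ^ 2 * (exp ℂ + 1) ≠ 0 :=
    mul_ne_zero (pow_ne_zero _ exp_sub_one_ne_zero) exp_add_one_ne_zero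
  apply mul_left_cancel₀ hne
  generalize exp ℂ = E at *
  linear_combination 2 * P * (E - 1) * h2 +
    (2 * X * (E ^ 2 + 1) - (E + 1) * (2 * P * (E - 1) + X * (E + 1))) * h

/-- The Riccati equation of the hyperbolic cotangent. -/
theorem evenBernoulliSeries_riccati :
    2 * eulerDeriv ℂ evenBernoulliSeries = evenBernoulliSeries - evenBernoulliSeries ^ 2 +
      C (1 / 4 : ℂ) * X := by
  apply expand_two_injective
  have h := expand_evenBernoulliSeries_mul
  have he : expand 2 two_ne_zero (2 * eulerDeriv ℂ evenBernoulliSeries) =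
      eulerDeriv ℂ (expand 2 two_ne_zero evenBernoulliSeries) := by
    rw [two_mul]
    ext n
    rw [coeff_eulerDeriv]
    rcases Nat.even_or_odd' n with ⟨k, rfl | rfl⟩
    · rw [coeff_expand_mul, coeff_expand_mul, map_add, coeff_eulerDeriv]
      push_cast
      ring
    · rw [coeff_expand_of_not_dvd _ _ _ (by omega), coeff_expand_of_not_dvd _ _ _ (by omega),
        mul_zero]
  have hd := congrArg (eulerDeriv ℂ) h
  have hE : eulerDeriv ℂ (exp ℂ) = X * exp ℂ := by
    rw [eulerDeriv_apply]; congr 1; exact derivative_exp ℂ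
  have hX : eulerDeriv ℂ (X : ℂ⟦X⟧) = X := by
    rw [eulerDeriv_apply, derivative_X, mul_one]
  have h2 : eulerDeriv ℂ (2 : ℂ⟦X⟧) = 0 := by
    rw [eulerDeriv_apply, ← map_ofNat (C (R := ℂ)) 2, derivative_C, mul_zero]
  have h4 : (4 : ℂ⟦X⟧) * C (1 / 4 : ℂ) = 1 := by
    rw [← map_ofNat (C (R := ℂ)) 4, ← map_mul]; simp
  simp only [Derivation.leibniz, map_sub, map_add, Derivation.map_one_eq_zero, hE, hX, h2,
    smul_eq_mul] at hd
  rw [he]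
  simp only [map_sub, map_add, map_mul, map_pow, expand_X, expand_C]
  generalize eulerDeriv ℂ (expand 2 two_ne_zero evenBernoulliSeries) = T at *
  generalize expand 2 two_ne_zero evenBernoulliSeries = P at *
  have hne : 4 * (exp ℂ - 1) ^ 2 ≠ 0 :=
    mul_ne_zero (left_ne_zero_of_mul_eq_one h4) (pow_ne_zero _ exp_sub_one_ne_zero)
  apply mul_left_cancel₀ hne
  generalize exp ℂ = E at *
  linear_combination 2 * (E - 1) * hd - 2 * X * E * h + (E - 1) * (-2) * h + (2 * P * (E - 1) +
    X * (E + 1)) * h - X ^ 2 * (E - 1) ^ 2 * h4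

/-- With `x = √X/2`, duplication gives `2x coth 2x - x coth x = x tanh x`, which is `X/4` over `x
coth x`. -/
theorem evenBernoulliSeries_mul_tangentBernoulliSeries :
    evenBernoulliSeries * (4 * tangentBernoulliSeries) = 1 := by
  apply mul_left_cancel₀ (X_ne_zero (R := ℂ))
  linear_combination 4 * evenBernoulliSeries * X_mul_tangentBernoulliSeries +
    evenBernoulliSeries_duplication

/-- The numbers `(2^{2n-1} - 1) B_{2n} / (2n)!`, with `0` for `n = 0`. -/
noncomputable def bernoulliLogCoeff (n : ℕ) : ℚ :=
  if n = 0 then 0 else (4 ^ n / 2 - 1) * (bernoulli (2 * n) / (2 * n).factorial)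

/-- Dividing the Riccati equation by `φ` leaves `X/(4φ)`, which duplication makes linear: `φ(4X) -
φ(X)`. -/
theorem hasLogDeriv_evenBernoulliSeries :
    HasLogDeriv evenBernoulliSeries (PowerSeries.mk fun n => (bernoulliLogCoeff n : ℂ)) := by
  have h4 : (4 : ℂ⟦X⟧) * C (1 / 4 : ℂ) = 1 := by
    rw [← map_ofNat (C (R := ℂ)) 4, ← map_mul]; simp
  have h2 : (2 : ℂ⟦X⟧) ≠ 0 := by
    rw [← map_ofNat (C (R := ℂ)) 2, Ne, map_eq_zero_iff _ C_injective]; norm_num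
  have hb : 2 * (PowerSeries.mk fun n => (bernoulliLogCoeff n : ℂ)) =
      1 - 2 * evenBernoulliSeries + rescale 4 evenBernoulliSeries := by
    ext n
    rw [← map_ofNat (C (R := ℂ)) 2, map_add, map_sub, coeff_C_mul, coeff_C_mul, coeff_rescale,
      coeff_one]
    simp only [evenBernoulliSeries, coeff_mk, bernoulliLogCoeff]
    split_ifs with hn
    · subst hn; norm_num
    · push_cast; ring
  apply mul_left_cancel₀ h2
  linear_combination evenBernoulliSeries_riccati - evenBernoulliSeries * hb -
    C (1 / 4 : ℂ) * evenBernoulliSeries_duplication +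
    (rescale 4 evenBernoulliSeries - evenBernoulliSeries) * evenBernoulliSeries * h4

/-! ### The product over roots of unity -/

/-- The root of unity `e^{π i / (m + 1)}`. -/
noncomputable def halfRoot (m : ℕ) : ℂ := Complex.exp (Real.pi * Complex.I / (m + 1))

theorem halfRoot_pow_succ (m : ℕ) : halfRoot m ^ (m + 1) = -1 := by
  have : ((m : ℂ) + 1) ≠ 0 := by exact_mod_cast m.succ_ne_zero
  rw [halfRoot, ← Complex.exp_nat_mul, ← Complex.exp_pi_mul_I]
  congr 1
  push_cast
  field_simp

theorem isPrimitiveRoot_halfRoot_sq (m : ℕ) : IsPrimitiveRoot (halfRoot m ^ 2) (m + 1) := by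
  have h := Complex.isPrimitiveRoot_exp (m + 1) m.succ_ne_zero
  convert h using 1
  rw [halfRoot, ← Complex.exp_nat_mul]
  congr 1
  push_cast
  ring

theorem mk_bernoulliConv (m : ℕ) :
    (PowerSeries.mk (bernoulliConv m)) =
      rescale (halfRoot m) tangentBernoulliSeries * evenBernoulliSeries := by
  ext n
  rw [coeff_mk, coeff_mul, bernoulliConv]
  simp only [coeff_rescale, tangentBernoulliSeries, evenBernoulliSeries, coeff_mk]
  rw [Finset.Nat.sum_antidiagonal_eq_sum_range_succ fun i j =>
    halfRoot m ^ i * (((4 : ℂ) ^ (i + 1) - 1) *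
      ((bernoulli (2 * i + 2) : ℂ) / ((2 * i + 2).factorial : ℂ))) *
        ((bernoulli (2 * j) : ℂ) / ((2 * j).factorial : ℂ))]
  refine sum_congr rfl fun l _ => ?_
  have : Complex.exp (Real.pi * Complex.I * l / (m + 1)) = halfRoot m ^ l := by
    rw [halfRoot, ← Complex.exp_nat_mul]
    congr 1
    ring
  rw [this, Nat.mul_sub]
  ring

theorem compositionSum_eq_coeff (m N : ℕ) :
    compositionSum m N = coeff N (∏ k : Fin (m + 1),
      rescale ((halfRoot m ^ 2) ^ (k : ℕ)) (PowerSeries.mk (bernoulliConv m))) := by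
  classical
  rw [coeff_prod, compositionSum]
  refine Finset.sum_nbij' (fun n => Finsupp.equivFunOnFinite.symm n) (fun n => ⇑n) ?_ ?_ ?_ ?_ ?_
  · intro n hn
    simpa using hn
  · intro n hn
    simpa using hn
  · intro n _; rfl
  · intro n _; ext; rfl
  · intro n _
    simp only [Finsupp.equivFunOnFinite_symm_apply_apply, coeff_rescale, coeff_mk]
    rw [prod_mul_distrib]
    congr 1
    rw [mul_sum, Complex.exp_sum]
    refine prod_congr rfl fun k _ => ?_
    rw [halfRoot, ← Complex.exp_nat_mul, ← Complex.exp_nat_mul, ← Complex.exp_nat_mul]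
    congr 1
    push_cast
    ring

/-- The product over `k ≤ m` of `φ(ω^{2k} X) / φ(ω^{2k+1} X)`, where `φ` is the even Bernoulli
series and `ω = e^{π i / (m + 1)}`. -/
noncomputable def bernoulliProduct (m : ℕ) : ℂ⟦X⟧ :=
  ∏ k : Fin (m + 1), rescale ((halfRoot m ^ 2) ^ (k : ℕ))
    (rescale (halfRoot m) (4 * tangentBernoulliSeries) * evenBernoulliSeries)

theorem coeff_bernoulliProduct (m N : ℕ) :
    coeff N (bernoulliProduct m) = 4 ^ (m + 1) * compositionSum m N := by
  have h4 : (4 : ℂ⟦X⟧) = C 4 := (map_ofNat (C (R := ℂ)) 4).symm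
  rw [compositionSum_eq_coeff, bernoulliProduct, ← coeff_C_mul]
  congr 1
  simp only [mk_bernoulliConv, map_mul, mul_assoc, map_ofNat]
  rw [prod_mul_distrib, prod_const, card_univ, Fintype.card_fin, h4, map_pow]

theorem constantCoeff_bernoulliProduct (m : ℕ) : coeff 0 (bernoulliProduct m) = 1 := by
  rw [bernoulliProduct, coeff_zero_eq_constantCoeff_apply, map_prod]
  refine prod_eq_one fun k _ => ?_
  rw [← coeff_zero_eq_constantCoeff_apply, coeff_rescale, pow_zero, one_mul,
    coeff_zero_eq_constantCoeff_apply, map_mul, ← coeff_zero_eq_constantCoeff_apply, coeff_rescale,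
    pow_zero, one_mul, coeff_zero_eq_constantCoeff_apply, ← map_mul, mul_comm,
    evenBernoulliSeries_mul_tangentBernoulliSeries, map_one]

theorem hasLogDeriv_bernoulliProduct (m : ℕ) :
    HasLogDeriv (bernoulliProduct m) (PowerSeries.mk fun n =>
      (∑ k : Fin (m + 1), ((halfRoot m ^ 2) ^ n) ^ (k : ℕ)) * (1 - halfRoot m ^ n) *
        (bernoulliLogCoeff n : ℂ)) := by
  have h0 := hasLogDeriv_evenBernoulliSeries
  have h1 := (h0.of_mul_eq_one evenBernoulliSeries_mul_tangentBernoulliSeries).rescale (halfRoot m)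
  have h2 := HasLogDeriv.prod (univ : Finset (Fin (m + 1)))
    fun k _ => (h1.mul h0).rescale ((halfRoot m ^ 2) ^ (k : ℕ))
  convert! h2 using 1
  ext n
  simp only [map_sum, coeff_mk, coeff_rescale, map_add, map_neg, sum_mul]
  refine sum_congr rfl fun k _ => ?_
  ring

theorem geom_halfRoot (m n : ℕ) :
    (∑ k : Fin (m + 1), ((halfRoot m ^ 2) ^ n) ^ (k : ℕ)) =
      if m + 1 ∣ n then (m : ℂ) + 1 else 0 := by
  have hprim := isPrimitiveRoot_halfRoot_sq m
  rw [Fin.sum_univ_eq_sum_range (fun k => ((halfRoot m ^ 2) ^ n) ^ k)]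
  split_ifs with h
  · rw [(hprim.pow_eq_one_iff_dvd n).2 h]
    simp
  · have hne : (halfRoot m ^ 2) ^ n ≠ 1 := fun h' => h ((hprim.pow_eq_one_iff_dvd n).1 h')
    rw [geom_sum_eq hne, ← pow_mul, mul_comm n, pow_mul, hprim.pow_eq_one, one_pow, sub_self,
      zero_div]

/-- The recursion for the coefficients of the powers of `X ^ (m + 1)` in `bernoulliProduct m`. -/
theorem mul_coeff_bernoulliProduct (m r : ℕ) :
    (r : ℂ) * coeff ((m + 1) * r) (bernoulliProduct m) = ∑ p ∈ antidiagonal r,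
      coeff ((m + 1) * p.1) (bernoulliProduct m) *
        ((1 - (-1) ^ p.2) * (bernoulliLogCoeff ((m + 1) * p.2) : ℂ)) := by
  have hm : ((m : ℂ) + 1) ≠ 0 := by exact_mod_cast m.succ_ne_zero
  have h := (hasLogDeriv_bernoulliProduct m).coeff ((m + 1) * r)
  simp only [coeff_mk, geom_halfRoot] at h
  apply mul_left_cancel₀ hm
  rw [← mul_assoc, mul_sum]
  push_cast at h
  rw [h]
  symm
  -- Only pairs of multiples of `m + 1` survive the root of unity filter.
  refine Finset.sum_of_injOn (fun p => ((m + 1) * p.1, (m + 1) * p.2)) ?_ ?_ ?_ ?_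
  · rintro ⟨a, b⟩ _ ⟨c, d⟩ _ h
    simpa using h
  · rintro ⟨a, b⟩ hp
    simp only [SetLike.mem_coe, HasAntidiagonal.mem_antidiagonal] at hp ⊢
    rw [← hp]; ring
  · rintro ⟨a, b⟩ hp hp'
    rw [if_neg, zero_mul, zero_mul, mul_zero]
    rintro ⟨j, hj⟩
    simp only at hj
    subst hj
    rw [HasAntidiagonal.mem_antidiagonal] at hp
    simp only at hp
    have hdvd : m + 1 ∣ a := (Nat.dvd_add_left (dvd_mul_right _ j)).1 (hp ▸ dvd_mul_right _ r)
    obtain ⟨i, rfl⟩ := hdvd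
    refine hp' ⟨(i, j), ?_, rfl⟩
    rw [SetLike.mem_coe, HasAntidiagonal.mem_antidiagonal]
    rw [← mul_add] at hp
    exact Nat.eq_of_mul_eq_mul_left m.succ_pos hp
  · rintro ⟨a, b⟩ _
    simp only [dvd_mul_right, if_true]
    rw [pow_mul, halfRoot_pow_succ]
    ring

/-! ### Alternating zeta values -/

theorem hasSum_alternating_of_hasSum {K : ℕ} {Z : ℝ}
    (hz : HasSum (fun n : ℕ => 1 / (n : ℝ) ^ (2 * K)) Z) :
    HasSum (fun n : ℕ => (-1 : ℝ) ^ n / (n : ℝ) ^ (2 * K)) (2 * (1 / 4 ^ K * Z) - Z) := by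
  have heven : HasSum (fun n : ℕ => 1 / ((2 * n : ℕ) : ℝ) ^ (2 * K)) (1 / 4 ^ K * Z) := by
    have e : (fun n : ℕ => 1 / ((2 * n : ℕ) : ℝ) ^ (2 * K)) =
        fun n : ℕ => 1 / 4 ^ K * (1 / (n : ℝ) ^ (2 * K)) := by
      ext n
      push_cast
      rw [mul_pow, pow_mul 2 2 K, one_div_mul_one_div]
      norm_num
    rw [e]
    exact hz.mul_left _
  have hodd : Summable fun n : ℕ => 1 / ((2 * n + 1 : ℕ) : ℝ) ^ (2 * K) :=
    hz.summable.comp_injective (i := fun n : ℕ => 2 * n + 1) fun a b h => by simpa using h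
  have htot := (heven.even_add_odd (f := fun n : ℕ => 1 / (n : ℝ) ^ (2 * K)) hodd.hasSum).unique hz
  have he : HasSum (fun n : ℕ => (-1 : ℝ) ^ (2 * n) / ((2 * n : ℕ) : ℝ) ^ (2 * K))
      (1 / 4 ^ K * Z) := by
    simpa only [pow_mul _ 2, neg_one_sq, one_pow] using heven
  have ho : HasSum (fun n : ℕ => (-1 : ℝ) ^ (2 * n + 1) / ((2 * n + 1 : ℕ) : ℝ) ^ (2 * K))
      (-∑' n : ℕ, 1 / ((2 * n + 1 : ℕ) : ℝ) ^ (2 * K)) := by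
    have e : (fun n : ℕ => (-1 : ℝ) ^ (2 * n + 1) / ((2 * n + 1 : ℕ) : ℝ) ^ (2 * K)) =
        fun n : ℕ => -(1 / ((2 * n + 1 : ℕ) : ℝ) ^ (2 * K)) := by
      ext n
      rw [(odd_two_mul_add_one n).neg_one_pow, neg_div]
    rw [e]
    exact hodd.hasSum.neg
  have h := he.even_add_odd (f := fun n : ℕ => (-1 : ℝ) ^ n / (n : ℝ) ^ (2 * K)) ho
  have hv : 2 * (1 / 4 ^ K * Z) - Z =
      1 / 4 ^ K * Z + -∑' n : ℕ, 1 / ((2 * n + 1 : ℕ) : ℝ) ^ (2 * K) := by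
    linarith
  rw [hv]
  exact h

theorem hasSum_alternating_zeta {K : ℕ} (hK : K ≠ 0) :
    HasSum (fun k : ℕ => (-1 : ℝ) ^ (k + 1) / ((k : ℝ) + 1) ^ (2 * K))
      ((-1) ^ K * Real.pi ^ (2 * K) * (bernoulliLogCoeff K : ℝ)) := by
  have halt := hasSum_alternating_of_hasSum (hasSum_zeta_nat hK)
  -- The dropped term `n = 0` is zero, as division by `0 ^ (2 * K)` gives 0.
  rw [← hasSum_nat_add_iff' 1] at halt
  simp only [Nat.cast_add, Nat.cast_one] at halt
  convert! halt using 1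
  have h2 : (2 : ℝ) ^ (2 * K - 1) = 4 ^ K / 2 := by
    rw [eq_div_iff two_ne_zero, ← pow_succ, Nat.sub_add_cancel (by omega), pow_mul]
    norm_num
  have h0 : (4 : ℝ) ^ K ≠ 0 := by positivity
  simp only [bernoulliLogCoeff, hK, if_false, h2, sum_range_one, Nat.cast_zero]
  rw [zero_pow (by omega), div_zero, sub_zero, pow_succ]
  push_cast
  generalize ((2 * K).factorial : ℝ) = f
  generalize Real.pi ^ (2 * K) = g
  field_simp
  ring

/-! ### Index blocks as Cayley increments -/

/-- The sequence `(-1)^n / n^{2m+2}` for `n = k + 1`. -/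
noncomputable def altPow (m k : ℕ) : ℝ := (-1) ^ (k + 1) / ((k : ℝ) + 1) ^ (2 * m + 2)

theorem summable_abs_altPow (m : ℕ) : Summable fun k => |altPow m k| := by
  have h := (hasSum_zeta_nat m.succ_ne_zero).summable.comp_injective Nat.succ_injective
  refine h.congr fun k => ?_
  have : (0 : ℝ) < ((k : ℝ) + 1) ^ (2 * m + 2) := by positivity
  rw [altPow, abs_div, abs_pow, abs_neg, abs_one, one_pow, abs_of_pos this]
  simp [mul_add]

theorem doubledSum_neg (x : ℕ → ℝ) (j : ℕ) : doubledSum (fun k => -x k) j = -doubledSum x j := by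
  simp only [doubledSum, sum_neg_distrib]
  ring

theorem HasStarCoeff.block {s : List ℕ} {c : ℕ → ℝ} (hc : HasStarCoeff s c) (m : ℕ) :
    HasStarCoeff (List.replicate m 2 ++ [3] ++ List.replicate m 2 ++ [1] ++ s)
      fun k => altPow m k * doubledSum (fun i => altPow m i * doubledSum c i) k := by
  have h := ((hc.cons_one.replicate_two m).cons_three).replicate_two m
  simp only [List.append_assoc, List.cons_append, List.nil_append] at h ⊢
  convert h using 2 with k
  have e : (fun i : ℕ => (-1 : ℝ) ^ i *
      (doubledSum c i / ((i : ℝ) + 1) / ((i : ℝ) + 1) ^ (2 * m) / ((i : ℝ) + 1))) =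
      fun i => -(altPow m i * doubledSum c i) := by
    ext i
    have : (i : ℝ) + 1 ≠ 0 := by positivity
    rw [altPow]
    field_simp
    ring
  rw [e, doubledSum_neg, altPow]
  have : (k : ℝ) + 1 ≠ 0 := by positivity
  field_simp
  ring

theorem index321_succ (m d : ℕ) : index321 m (d + 1) =
    List.replicate m 2 ++ [3] ++ List.replicate m 2 ++ [1] ++ index321 m d := by
  rw [index321, List.replicate_succ, List.flatten_cons, index321]

/-- The empty index has `D c = 2`, so the first block gives `y D(2y)`, which is increment number 1;
each further block raises the number by 2. -/
theorem hasStarCoeff_index321 (m d : ℕ) :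
    HasStarCoeff (index321 m (d + 1)) (cayleyIncr (altPow m) (2 * d + 1)) := by
  have step (d : ℕ) : cayleyIncr (altPow m) (2 * (d + 1) + 1) = fun k =>
      altPow m k * doubledSum (fun i => altPow m i *
        doubledSum (cayleyIncr (altPow m) (2 * d + 1)) i) k := by
    ext k
    rw [show 2 * (d + 1) + 1 = 2 * d + 1 + 1 + 1 by ring, cayleyIncr_succ,
      funext (cayleyIncr_succ (altPow m) (2 * d + 1))]
  induction d with
  | zero =>
    rw [index321_succ]
    convert! hasStarCoeff_nil.block m using 1
    ext k
    rw [cayleyIncr_succ]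
    congr 2
    ext i
    rw [cayleyIncr_zero, doubledSum_alternating]
    ring
  | succ d ih =>
    rw [index321_succ, step]
    exact ih.block m

/-- The tail of twos has coefficients `-2y`, minus increment number 0; hence the odd powers of `X`
and the sign. -/
theorem hasStarCoeff_index321_append (m d : ℕ) :
    HasStarCoeff (index321 m d ++ List.replicate (m + 1) 2)
      fun k => -cayleyIncr (altPow m) (2 * d) k := by
  induction d with
  | zero =>
    have h := hasStarCoeff_nil.replicate_two (m + 1)
    rw [List.append_nil] at h
    rw [show index321 m 0 = [] from rfl, List.nil_append]
    convert h using 2 with k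
    rw [mul_zero, cayleyIncr_zero, altPow]
    ring
  | succ d ih =>
    rw [index321_succ, List.append_assoc]
    convert ih.block m using 2 with k
    rw [show 2 * (d + 1) = 2 * d + 1 + 1 by ring, cayleyIncr_succ,
      funext (cayleyIncr_succ (altPow m) (2 * d))]
    simp only [doubledSum_neg, mul_neg]

/-- The limits of the power sum differences of `altPow m`. -/
noncomputable def altPowerSum (m j : ℕ) : ℝ :=
  ((-1) ^ (m + 1) * Real.pi ^ (2 * (m + 1))) ^ j *
    ((1 - (-1) ^ j) * (bernoulliLogCoeff ((m + 1) * j) : ℝ))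

open Filter Topology in
theorem tendsto_altPowerSum (m j : ℕ) :
    Tendsto (fun n => ∑ k ∈ range n, (altPow m k ^ j - (-altPow m k) ^ j)) atTop
      (𝓝 (altPowerSum m j)) := by
  rcases Nat.even_or_odd j with hj | hj
  · simp [altPowerSum, hj.neg_pow]
  · have hK : (m + 1) * j ≠ 0 := mul_ne_zero m.succ_ne_zero hj.pos.ne'
    convert! ((hasSum_alternating_zeta hK).mul_left 2).tendsto_sum_nat using 2
    · refine sum_congr rfl fun k _ => ?_
      rw [hj.neg_pow, altPow, div_pow, ← pow_mul, ← pow_mul, mul_comm (k + 1) j, pow_mul,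
        hj.neg_one_pow, show (2 * m + 2) * j = 2 * ((m + 1) * j) by ring]
      ring
    · rw [altPowerSum, hj.neg_one_pow, mul_pow, ← pow_mul, ← pow_mul, mul_assoc 2 (m + 1) j]
      ring

/-! ### Newton's recursion and conclusion -/

theorem eq_of_newton_recursion {u v a : ℕ → ℂ} (h0 : u 0 = v 0) (ha : a 0 = 0)
    (hu : ∀ r : ℕ, r * u r = ∑ p ∈ antidiagonal r, u p.1 * a p.2)
    (hv : ∀ r : ℕ, r * v r = ∑ p ∈ antidiagonal r, v p.1 * a p.2) (r : ℕ) : u r = v r := by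
  induction r using Nat.strong_induction_on with
  | _ r ih =>
    rcases Nat.eq_zero_or_pos r with rfl | hr
    · exact h0
    · have hr' : (r : ℂ) ≠ 0 := by exact_mod_cast hr.ne'
      apply mul_left_cancel₀ hr'
      rw [hu, hv]
      refine sum_congr rfl fun p hp => ?_
      rw [HasAntidiagonal.mem_antidiagonal] at hp
      rcases Nat.eq_zero_or_pos p.2 with h | h
      · rw [h, ha, mul_zero, mul_zero]
      · rw [ih p.1 (by omega)]

theorem rational_of_newton_recursion {q b : ℕ → ℝ} {c : ℝ} (h0 : q 0 = 1)
    (hb : ∀ j, ∃ x : ℚ, b j = x) (hb0 : b 0 = 0)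
    (hq : ∀ r : ℕ, r * q r = ∑ p ∈ antidiagonal r, q p.1 * (c ^ p.2 * b p.2)) (r : ℕ) :
    ∃ x : ℚ, q r = x * c ^ r := by
  induction r using Nat.strong_induction_on with
  | _ r ih =>
    rcases Nat.eq_zero_or_pos r with rfl | hr
    · exact ⟨1, by simp [h0]⟩
    · have hterm (p : ℕ × ℕ) (hp : p ∈ antidiagonal r) :
          ∃ x : ℚ, q p.1 * (c ^ p.2 * b p.2) = x * c ^ r := by
        rw [HasAntidiagonal.mem_antidiagonal] at hp
        rcases Nat.eq_zero_or_pos p.2 with h | h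
        · exact ⟨0, by simp [h, hb0]⟩
        · obtain ⟨x, hx⟩ := ih p.1 (by omega)
          obtain ⟨z, hz⟩ := hb p.2
          refine ⟨x * z, ?_⟩
          rw [hx, hz, ← hp, pow_add]
          push_cast
          ring
      choose! x hx using hterm
      refine ⟨(∑ p ∈ antidiagonal r, x p) / r, ?_⟩
      have hr' : (r : ℝ) ≠ 0 := by positivity
      apply mul_left_cancel₀ hr'
      rw [hq, sum_congr rfl hx, ← sum_mul]
      push_cast
      field_simp

open Filter Topology in
/-- The coefficients of `∏_n (1 + y_n X) / (1 - y_n X)` for `y_n = (-1)^n / n^{2m+2}`. -/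
theorem exists_tendsto_cayleyCoeff_altPow (m : ℕ) : ∃ q : ℕ → ℝ,
    (∀ r, Tendsto (cayleyCoeff (altPow m) r) atTop (𝓝 (q r))) ∧
    (∀ r, (q r : ℂ) = ((-1) ^ (m + 1) * (Real.pi : ℂ) ^ (2 * (m + 1))) ^ r *
      (4 ^ (m + 1) * compositionSum m ((m + 1) * r))) ∧
    ∀ r, ∃ x : ℚ, q r = x * ((-1) ^ (m + 1) * Real.pi ^ (2 * (m + 1))) ^ r := by
  obtain ⟨q, hq0, hq, hrec⟩ := exists_tendsto_cayleyCoeff (tendsto_altPowerSum m)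
  refine ⟨q, hq, fun r => ?_, fun r => ?_⟩
  · rw [← coeff_bernoulliProduct]
    refine eq_of_newton_recursion (u := fun r => (q r : ℂ))
      (v := fun r => ((-1) ^ (m + 1) * (Real.pi : ℂ) ^ (2 * (m + 1))) ^ r *
        coeff ((m + 1) * r) (bernoulliProduct m)) (a := fun j => (altPowerSum m j : ℂ))
      ?_ ?_ (fun r => ?_) (fun r => ?_) r
    · simp only [hq0, mul_zero, constantCoeff_bernoulliProduct]
      simp
    · simp [altPowerSum]
    · exact_mod_cast hrec r
    · rw [mul_left_comm, mul_coeff_bernoulliProduct, mul_sum]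
      refine sum_congr rfl fun p hp => ?_
      rw [← HasAntidiagonal.mem_antidiagonal.1 hp, pow_add, altPowerSum]
      push_cast
      ring
  · refine rational_of_newton_recursion
      (b := fun j => (1 - (-1) ^ j) * (bernoulliLogCoeff ((m + 1) * j) : ℝ)) hq0
      (fun j => ⟨(1 - (-1) ^ j) * bernoulliLogCoeff ((m + 1) * j), by push_cast; rfl⟩)
      (by simp) hrec r

theorem neg_one_pow_pow_even {R : Type*} [CommRing R] (a d : ℕ) :
    ((-1 : R) ^ a) ^ (2 * d) = 1 := by
  rw [← pow_mul, mul_left_comm]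
  exact (even_two_mul _).neg_one_pow

theorem theorem3 (m d : ℕ) (hd : 1 ≤ d) :
    (ZetaStarConverges (index321 m d) ∧
      (zetaStar (index321 m d) : ℂ) =
        4 ^ (m + 1) * (Real.pi : ℂ) ^ (4 * d * (m + 1)) *
          compositionSum m (2 * (m + 1) * d)) ∧
    (ZetaStarConverges (index321 m d ++ List.replicate (m + 1) 2) ∧
      (zetaStar (index321 m d ++ List.replicate (m + 1) 2) : ℂ) =
        (-1) ^ m * 4 ^ (m + 1) * (Real.pi : ℂ) ^ ((4 * d + 2) * (m + 1)) *
          compositionSum m ((m + 1) * (2 * d + 1))) ∧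
    (∃ q : ℚ, zetaStar (index321 m d) = q * Real.pi ^ (4 * (m + 1) * d)) ∧
    (∃ q : ℚ, zetaStar (index321 m d ++ List.replicate (m + 1) 2) =
      q * Real.pi ^ (2 * (m + 1) * (2 * d + 1))) := by
  obtain ⟨q, hq, hval, hrat⟩ := exists_tendsto_cayleyCoeff_altPow m
  have hsum (r : ℕ) := hasSum_cayleyIncr (summable_abs_altPow m) (hq r) (hq (r + 1))
  have h1 : HasSum (fun k : StarIndex (index321 m d).length => mzvTerm (index321 m d) k.1)
      (q (2 * d)) := by
    obtain ⟨d, rfl⟩ := Nat.exists_eq_add_of_le' hd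
    have h := (hasStarCoeff_index321 m d).tendsto (hsum (2 * d + 1)).1
    rw [(hsum (2 * d + 1)).2] at h
    exact hasSum_mzvTerm_of_tendsto h
  have h2 : HasSum (fun k : StarIndex (index321 m d ++ List.replicate (m + 1) 2).length =>
      mzvTerm (index321 m d ++ List.replicate (m + 1) 2) k.1) (-q (2 * d + 1)) := by
    have h := (hasStarCoeff_index321_append m d).tendsto (by simpa using (hsum (2 * d)).1)
    rw [tsum_neg, (hsum (2 * d)).2] at h
    exact hasSum_mzvTerm_of_tendsto h
  have e1 : zetaStar (index321 m d) = q (2 * d) := h1.tsum_eq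
  have e2 : zetaStar (index321 m d ++ List.replicate (m + 1) 2) = -q (2 * d + 1) := h2.tsum_eq
  refine ⟨⟨h1.summable, ?_⟩, ⟨h2.summable, ?_⟩, ?_, ?_⟩
  · rw [e1, hval, mul_pow, neg_one_pow_pow_even, ← pow_mul,
      show 2 * (m + 1) * (2 * d) = 4 * d * (m + 1) by ring,
      show (m + 1) * (2 * d) = 2 * (m + 1) * d by ring]
    ring
  -- The odd power leaves `(-1)^(m+1)`, which the minus sign turns into `(-1)^m`.
  · rw [e2, Complex.ofReal_neg, hval, mul_pow, pow_succ _ (2 * d), neg_one_pow_pow_even, ← pow_mul,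
      show 2 * (m + 1) * (2 * d + 1) = (4 * d + 2) * (m + 1) by ring]
    ring
  · obtain ⟨x, hx⟩ := hrat (2 * d)
    refine ⟨x, ?_⟩
    rw [e1, hx, mul_pow, neg_one_pow_pow_even, ← pow_mul, one_mul,
      show 2 * (m + 1) * (2 * d) = 4 * (m + 1) * d by ring]
  · obtain ⟨x, hx⟩ := hrat (2 * d + 1)
    refine ⟨(-1) ^ m * x, ?_⟩
    rw [e2, hx, mul_pow, pow_succ _ (2 * d), neg_one_pow_pow_even, ← pow_mul]
    push_cast
    ring
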